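/- Let $X$ be a compact metrizable space and let $T$ be a homomorphism from a countable group $\Gamma$ to the group of homeomorphisms of $X$. Let $\mathrm{Cov}(X)$ be the set of finite open covers of $X$; for $\mathcal U,\mathcal V\in\mathrm{Cov}(X)$ write $\mathcal V\succeq\mathcal U$ if every $V\in\mathcal V$ is contained in some $U\in\mathcal U$. Let $\mathrm{Prob}(X,T)$ be the set of $T$-invariant Borel probability measures on $X$, and define $$\dim(X,T)=\sup_{\mathcal U\in\mathrm{Cov}(X)}\ \inf_{\substack{\mathcal V\in\mathrm{Cov}(X)\\ \mathcal V\succeq\mathcal U}}\ \sup_{\mu\in\mathrm{Prob}(X,T)}\int_X\Big(-1+\sum_{V\in\mathcal V}\mathbf 1_V(x)\Big)\,d\mu(x)\in[-\infty,+\infty],$$ where the supremum over an empty set of measures is $-\infty$. **Theorem.** Let $\Gamma$ be a countable (possibly finite) group and let $d\in\mathbb N=\{0,1,2,\dots\}$. Equip $([0,1]^d)^\Gamma$ with the product topology and the left-shift action $(\mathrm{shift}_\gamma(x))_{\gamma'}=x_{\gamma^{-1}\gamma'}$ of $\Gamma$. Then $$\dim\big(([0,1]^d)^\Gamma,\mathrm{shift}\big)=d.$$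 -/

import Mathlib

open MeasureTheory

noncomputable section

namespace CubicalShift

/-- The order of a finite collection `𝒱` of subsets of `X` at the point `x`:
`-1 + ∑_{V ∈ 𝒱} 1_V(x)`. -/
def ordAt {X : Type*} (𝒱 : Finset (Set X)) (x : X) : ℝ :=
  -1 + ∑ V ∈ 𝒱, V.indicator (fun _ => (1 : ℝ)) x

/-- `𝒱` is a finite open cover of `X`. -/
def IsOpenCover {X : Type*} [TopologicalSpace X] (𝒱 : Finset (Set X)) : Prop :=
  (∀ V ∈ 𝒱, IsOpen V) ∧ ∀ x : X, ∃ V ∈ 𝒱, x ∈ V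

/-- `𝒱` refines `𝒰`: each member of `𝒱` is contained in some member of `𝒰`. -/
def Refines {X : Type*} (𝒱 𝒰 : Finset (Set X)) : Prop :=
  ∀ V ∈ 𝒱, ∃ U ∈ 𝒰, V ⊆ U

section Pair

variable {X : Type*} [TopologicalSpace X] [MeasurableSpace X] [BorelSpace X]

/-- `ord(𝒱, P) = sup_{μ ∈ P} ∫ ord(𝒱, x) dμ(x)`, as an extended real; it is `-∞` for `P = ∅`.
The integrand is bounded, and Borel when the members of `𝒱` are. -/
def ordPair (𝒱 : Finset (Set X)) (P : Set (ProbabilityMeasure X)) : EReal :=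
  ⨆ μ ∈ P, ((∫ x, ordAt 𝒱 x ∂(μ : Measure X) : ℝ) : EReal)

/-- `dim(𝒰, P)`: the infimum of `ord(𝒱, P)` over the finite open covers `𝒱` refining `𝒰`. -/
def dimCover (𝒰 : Finset (Set X)) (P : Set (ProbabilityMeasure X)) : EReal :=
  ⨅ 𝒱 : Finset (Set X), ⨅ _ : IsOpenCover 𝒱 ∧ Refines 𝒱 𝒰, ordPair 𝒱 P

variable (X) in
/-- `dim(X, P)`: the supremum of `dim(𝒰, P)` over the finite open covers `𝒰` of `X`.
For `P = ∅` this is `-∞`. -/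
def dimPair (P : Set (ProbabilityMeasure X)) : EReal :=
  ⨆ 𝒰 : Finset (Set X), ⨆ _ : IsOpenCover 𝒰, dimCover 𝒰 P

/-- The Borel probability measures on `X` invariant under the action `T` of `Γ` on `X` by
homeomorphisms. -/
def invariantProb {Γ : Type*} [Group Γ] (T : Γ →* (X ≃ₜ X)) : Set (ProbabilityMeasure X) :=
  {μ | ∀ γ : Γ, (μ : Measure X).map (T γ) = (μ : Measure X)}

/-- The dimension `dim(X, T)` of the dynamical system `(X, T)`. -/
def dimSystem {Γ : Type*} [Group Γ] (T : Γ →* (X ≃ₜ X)) : EReal :=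
  dimPair X (invariantProb T)

end Pair

/-- The left shift action of `Γ` on `K^Γ` (with the product topology):
`(shift γ x) γ' = x (γ⁻¹ * γ')`. -/
def shift (Γ : Type*) [Group Γ] (K : Type*) [TopologicalSpace K] :
    Γ →* ((Γ → K) ≃ₜ (Γ → K)) where
  toFun γ :=
    { toFun := fun x γ' => x (γ⁻¹ * γ')
      invFun := fun x γ' => x (γ * γ')
      left_inv := fun x => by funext γ'; simp
      right_inv := fun x => by funext γ'; simp
      continuous_toFun := by fun_prop
      continuous_invFun := by fun_prop }
  map_one' := by ext x γ'; simp
  map_mul' γ₁ γ₂ := by ext x γ'; simp [mul_assoc]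

end CubicalShift

end

/-!
Lower bound: constant configurations are fixed by the shift, so their Dirac masses are invariant and
it suffices that every fine enough open cover of the cube has order at least `d` at some point. This
is Lebesgue's covering theorem, which follows from the Poincaré–Miranda theorem. The discrete form
of the latter is cohomological: the coboundaries of the indicators of `d` sets of lattice points,
the `k`-th of which avoids the facet `v k = 0` and contains the facet `v k = n`, have a cup product
that integrates to `1` over the grid by Stokes' theorem; hence it is nonzero on some simplex of the
grid, which is then mixed for all `d` sets at once.

Upper bound: measure the coordinates `x γ j` for `γ` in a large finite `F ⊆ Γ` in small units. Cells
of a cubical subdivision, slightly enlarged, form a fine cover whose order at `x` is at most the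
number of pairs `(γ, j)` for which `x γ j` is close to a wall `ℤ + c γ`. By invariance `x γ j` has
the distribution of `x 1 j` for every `γ`. If the offsets `c γ` are distinct modulo `1` and the
enlargement is small, then for each `j` the neighbourhoods of the walls are disjoint over `γ`, so
the expected number of such pairs is at most `d`.
-/

namespace CubicalShift

section Covers

variable {X Y : Type*}

theorem ordAt_eq_card (𝒱 : Finset (Set X)) (x : X) [DecidablePred fun V : Set X => x ∈ V] :
    ordAt 𝒱 x = -1 + ((𝒱.filter fun V => x ∈ V).card : ℝ) := by
  simp [ordAt, Set.indicator_apply]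

theorem integrable_ordAt [TopologicalSpace X] [MeasurableSpace X] [BorelSpace X]
    {𝒱 : Finset (Set X)} (h𝒱 : IsOpenCover 𝒱) (μ : Measure X) [IsFiniteMeasure μ] :
    Integrable (ordAt 𝒱) μ :=
  (integrable_const _).add (integrable_finsetSum _ fun V hV =>
    (integrable_const (1 : ℝ)).indicator (h𝒱.1 V hV).measurableSet)

open Classical in
/-- The cover of `Y` by the preimages under `f` of the members of a cover of `X`. Distinct members
with the same preimage are merged. -/
noncomputable def pullback (f : Y → X) (𝒱 : Finset (Set X)) : Finset (Set Y) :=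
  𝒱.image (f ⁻¹' ·)

theorem mem_pullback {f : Y → X} {𝒱 : Finset (Set X)} {W : Set Y} :
    W ∈ pullback f 𝒱 ↔ ∃ V ∈ 𝒱, f ⁻¹' V = W := by
  classical
  exact Finset.mem_image

theorem IsOpenCover.pullback [TopologicalSpace X] [TopologicalSpace Y] {f : Y → X}
    (hf : Continuous f) {𝒱 : Finset (Set X)} (h𝒱 : IsOpenCover 𝒱) :
    IsOpenCover (pullback f 𝒱) := by
  simp only [IsOpenCover, mem_pullback]
  refine ⟨?_, fun y => ?_⟩
  · rintro _ ⟨V, hV, rfl⟩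
    exact (h𝒱.1 V hV).preimage hf
  · obtain ⟨V, hV, hy⟩ := h𝒱.2 (f y)
    exact ⟨_, ⟨V, hV, rfl⟩, hy⟩

theorem Refines.pullback_of_leftInverse {f : Y → X} {g : X → Y} (hgf : Function.LeftInverse g f)
    {𝒱 : Finset (Set X)} {𝒰 : Finset (Set Y)} (h : Refines 𝒱 (pullback g 𝒰)) :
    Refines (pullback f 𝒱) 𝒰 := by
  intro W hW
  obtain ⟨V, hV, rfl⟩ := mem_pullback.1 hW
  obtain ⟨_, hU', hVU⟩ := h V hV
  obtain ⟨U, hU, rfl⟩ := mem_pullback.1 hU'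
  refine ⟨U, hU, fun y hy => ?_⟩
  rw [← hgf y]
  exact hVU hy

theorem ordAt_pullback_le (f : Y → X) (𝒱 : Finset (Set X)) (y : Y) :
    ordAt (pullback f 𝒱) y ≤ ordAt 𝒱 (f y) := by
  classical
  have hsub : (pullback f 𝒱).filter (y ∈ ·) ⊆ (𝒱.filter (f y ∈ ·)).image (f ⁻¹' ·) := by
    intro W hW
    simp only [Finset.mem_filter, mem_pullback] at hW
    obtain ⟨⟨V, hV, rfl⟩, hy⟩ := hW
    exact Finset.mem_image_of_mem _ (Finset.mem_filter.2 ⟨hV, hy⟩)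
  rw [ordAt_eq_card, ordAt_eq_card]
  gcongr
  exact (Finset.card_le_card hsub).trans Finset.card_image_le

end Covers

section Cochains

variable {V W R : Type*} [CommRing R]

/-- The simplicial coboundary. A cochain on the vertex set `V` is a function on lists of vertices,
all degrees together; the empty list is the augmentation simplex of degree `-1`. -/
def coboundary : (List V → R) →ₗ[R] (List V → R) :=
  LinearMap.pi fun L => ∑ i ∈ Finset.range L.length, (-1 : R) ^ i • LinearMap.proj (L.eraseIdx i)

/-- The transpose of the prism operator between the vertex maps `a` and `b`, that is
`(v₀, …, vₖ) ↦ ∑ i, (-1) ^ i (a v₀, …, a vᵢ, b vᵢ, …, b vₖ)`. -/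
def prism (a b : V → W) : (List W → R) →ₗ[R] (List V → R) :=
  LinearMap.pi fun L => ∑ i ∈ Finset.range L.length,
    (-1 : R) ^ i • LinearMap.proj ((L.take (i + 1)).map a ++ (L.drop i).map b)

@[simp]
theorem coboundary_nil (ω : List V → R) : coboundary ω [] = 0 := by
  simp [coboundary]

theorem coboundary_cons (ω : List V → R) (v : V) (L : List V) :
    coboundary ω (v :: L) = ω L - coboundary (ω ∘ List.cons v) L := by
  simp [coboundary, Finset.sum_range_succ', pow_succ, sub_eq_neg_add]

theorem coboundary_comp_cons (ω : List V → R) (v : V) :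
    coboundary ω ∘ List.cons v = ω - coboundary (ω ∘ List.cons v) :=
  funext (coboundary_cons ω v)

theorem coboundary_coboundary (ω : List V → R) : coboundary (coboundary ω) = 0 := by
  funext L
  induction L generalizing ω with
  | nil => simp
  | cons v L ih => simp [coboundary_cons, coboundary_comp_cons, ih]

theorem coboundary_comp_map (b : V → W) (ω : List W → R) (L : List V) :
    coboundary (ω ∘ List.map b) L = coboundary ω (L.map b) := by
  induction L generalizing ω with
  | nil => simp
  | cons v L ih =>
    rw [List.map_cons, coboundary_cons, coboundary_cons, ← ih]
    rfl

@[simp]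
theorem prism_nil (a b : V → W) (ω : List W → R) : prism a b ω [] = 0 := by
  simp [prism]

theorem prism_cons (a b : V → W) (ω : List W → R) (v : V) (L : List V) :
    prism a b ω (v :: L) = ω (a v :: b v :: L.map b) - prism a b (ω ∘ List.cons (a v)) L := by
  simp [prism, Finset.sum_range_succ', pow_succ, sub_eq_neg_add]

theorem prism_comp_cons (a b : V → W) (ω : List W → R) (v : V) :
    prism a b ω ∘ List.cons v = ((ω ∘ List.cons (a v)) ∘ List.cons (b v)) ∘ List.map b -
      prism a b (ω ∘ List.cons (a v)) :=
  funext (prism_cons a b ω v)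

theorem prism_coboundary (a b : V → W) (ω : List W → R) (L : List V) :
    prism a b (coboundary ω) L =
      ω (L.map b) - ω (L.map a) - coboundary (prism a b ω) L := by
  induction L generalizing ω with
  | nil => simp
  | cons v L ih =>
    simp only [prism_cons, coboundary_cons, coboundary_comp_cons, prism_comp_cons,
      coboundary_comp_map, map_sub, Pi.sub_apply, ih, List.map_cons, Function.comp_apply]
    ring

theorem exists_of_prism_ne_zero {a b : V → W} {ω : List W → R} {L : List V}
    (h : prism a b ω L ≠ 0) : ∃ L', ω L' ≠ 0 ∧ ∀ w ∈ L', ∃ v ∈ L, w = a v ∨ w = b v := by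
  simp only [prism, LinearMap.pi_apply, LinearMap.sum_apply] at h
  obtain ⟨i, -, hi⟩ := Finset.exists_ne_zero_of_sum_ne_zero h
  refine ⟨_, right_ne_zero_of_mul hi, fun w hw => ?_⟩
  simp only [List.mem_append, List.mem_map] at hw
  rcases hw with ⟨v, hv, rfl⟩ | ⟨v, hv, rfl⟩
  · exact ⟨v, List.mem_of_mem_take hv, .inl rfl⟩
  · exact ⟨v, List.mem_of_mem_drop hv, .inr rfl⟩

/-- The cup product of a `0`-cochain with a cochain. -/
def cupZero (g : V → R) (θ : List V → R) : List V → R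
  | [] => 0
  | v :: L => g v * θ (v :: L)

/-- The cup product `δfₖ₋₁ ∪ ⋯ ∪ δf₀` of coboundaries of `0`-cochains, built as
`δ(fₖ₋₁ ∪ (δfₖ₋₂ ∪ ⋯ ∪ δf₀))`. -/
def cupCoboundaries (f : ℕ → V → R) : ℕ → List V → R
  | 0 => fun L => if L.length = 1 then 1 else 0
  | k + 1 => coboundary (cupZero (f k) (cupCoboundaries f k))

theorem cupZero_comp_map (b : V → W) (g : W → R) (θ : List W → R) :
    cupZero g θ ∘ List.map b = cupZero (g ∘ b) (θ ∘ List.map b) := by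
  funext L
  cases L <;> rfl

theorem cupCoboundaries_comp_map (b : V → W) (f : ℕ → W → R) (k : ℕ) :
    cupCoboundaries f k ∘ List.map b = cupCoboundaries (fun j => f j ∘ b) k := by
  induction k with
  | zero =>
    funext L
    simp [cupCoboundaries]
  | succ k ih =>
    funext L
    rw [cupCoboundaries, cupCoboundaries, ← ih, ← cupZero_comp_map, coboundary_comp_map]
    rfl

theorem coboundary_cupCoboundaries (f : ℕ → V → R) (k : ℕ) :
    coboundary (cupCoboundaries f k) = 0 := by
  cases k with
  | zero =>
    funext L
    match L with
    | [] => simp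
    | [v] => simp [coboundary_cons, cupCoboundaries]
    | [v, w] => simp [coboundary_cons, cupCoboundaries]
    | u :: v :: w :: L =>
      have hzero : (cupCoboundaries f 0 ∘ List.cons u) ∘ List.cons v = 0 := by
        funext L
        simp [cupCoboundaries]
      rw [coboundary_cons, coboundary_cons, hzero, map_zero]
      simp [cupCoboundaries]
  | succ k => exact coboundary_coboundary _

theorem coboundary_cupZero_cons {θ : List V → R} (hθ : coboundary θ = 0) (g : V → R) (v : V)
    (L : List V) : coboundary (cupZero g θ) (v :: L) = cupZero g θ L - g v * θ L := by
  have hclosed : θ L = coboundary (θ ∘ List.cons v) L := by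
    rw [← sub_eq_zero, ← coboundary_cons, hθ, Pi.zero_apply]
  have hcup : cupZero g θ ∘ List.cons v = g v • (θ ∘ List.cons v) := rfl
  rw [coboundary_cons, hcup, map_smul, Pi.smul_apply, ← hclosed, smul_eq_mul]

@[simp]
theorem cupCoboundaries_nil (f : ℕ → V → R) (k : ℕ) : cupCoboundaries f k [] = 0 := by
  cases k <;> simp [cupCoboundaries]

theorem cupCoboundaries_succ_singleton (f : ℕ → V → R) (k : ℕ) (v : V) :
    cupCoboundaries f (k + 1) [v] = 0 := by
  simp [cupCoboundaries, coboundary_cupZero_cons (coboundary_cupCoboundaries f k), cupZero]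

theorem cupCoboundaries_succ_cons_cons (f : ℕ → V → R) (k : ℕ) (v w : V) (L : List V) :
    cupCoboundaries f (k + 1) (v :: w :: L) = (f k w - f k v) * cupCoboundaries f k (w :: L) := by
  rw [cupCoboundaries, coboundary_cupZero_cons (coboundary_cupCoboundaries f k), cupZero, sub_mul]

theorem exists_ne_of_cupCoboundaries_ne_zero {f : ℕ → V → R} {k : ℕ} {L : List V}
    (h : cupCoboundaries f k L ≠ 0) {j : ℕ} (hj : j < k) :
    ∃ v ∈ L, ∃ w ∈ L, f j v ≠ f j w := by
  induction k generalizing L with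
  | zero => exact absurd hj j.not_lt_zero
  | succ k ih =>
    match L with
    | [] => exact absurd (cupCoboundaries_nil f _) h
    | [v] => exact absurd (cupCoboundaries_succ_singleton f k v) h
    | v :: w :: L =>
      rw [cupCoboundaries_succ_cons_cons] at h
      rcases Nat.lt_succ_iff_lt_or_eq.1 hj with hj | rfl
      · obtain ⟨x, hx, y, hy, hxy⟩ := ih (right_ne_zero_of_mul h) hj
        exact ⟨x, List.mem_cons_of_mem _ hx, y, List.mem_cons_of_mem _ hy, hxy⟩
      · exact ⟨w, by simp, v, by simp, sub_ne_zero.1 (left_ne_zero_of_mul h)⟩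

end Cochains

section Grid

variable {R : Type*} [CommRing R]

/-- Integration of a cochain over the interval `{0, …, n}` in the coordinate `d`. -/
def fiberIntegral (n d : ℕ) : (List (ℕ → ℕ) → R) →ₗ[R] (List (ℕ → ℕ) → R) :=
  ∑ m ∈ Finset.range n,
    prism (fun v => Function.update v d m) (fun v => Function.update v d (m + 1))

/-- Integration of a cochain over the grid `{0, …, n} ^ d`, in its standard triangulation. A grid
point is a sequence of which only the first `d` entries matter. -/
def gridIntegral (n : ℕ) : ℕ → (List (ℕ → ℕ) → R) →ₗ[R] R
  | 0 => LinearMap.proj [0]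
  | d + 1 => gridIntegral n d ∘ₗ fiberIntegral n d

variable {n d : ℕ} {ω θ : List (ℕ → ℕ) → R}

theorem fiberIntegral_apply (n d : ℕ) (ω : List (ℕ → ℕ) → R) :
    fiberIntegral n d ω = ∑ m ∈ Finset.range n,
      prism (fun v => Function.update v d m) (fun v => Function.update v d (m + 1)) ω := by
  simp [fiberIntegral]

theorem fiberIntegral_coboundary (n d : ℕ) (ω : List (ℕ → ℕ) → R) :
    fiberIntegral n d (coboundary ω) =
      ω ∘ List.map (fun v => Function.update v d n) -
        ω ∘ List.map (fun v => Function.update v d 0) - coboundary (fiberIntegral n d ω) := by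
  funext L
  simp only [fiberIntegral_apply, map_sum, Finset.sum_apply, prism_coboundary,
    Finset.sum_sub_distrib, Pi.sub_apply, Function.comp_apply]
  rw [← Finset.sum_sub_distrib, Finset.sum_range_sub fun m => ω (L.map fun v =>
    Function.update v d m)]

theorem exists_of_fiberIntegral_ne_zero {L : List (ℕ → ℕ)} (h : fiberIntegral n d ω L ≠ 0) :
    ∃ m L', ω L' ≠ 0 ∧ ∀ w ∈ L', ∃ v ∈ L,
      w = Function.update v d m ∨ w = Function.update v d (m + 1) := by
  rw [fiberIntegral_apply, Finset.sum_apply] at h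
  obtain ⟨m, -, hm⟩ := Finset.exists_ne_zero_of_sum_ne_zero h
  exact ⟨m, exists_of_prism_ne_zero hm⟩

/-- The unit cell of the grid `ℕ ^ d` with lowest corner `b`. -/
def gridCell (d : ℕ) (b : ℕ → ℕ) : Set (ℕ → ℕ) :=
  {v | ∀ k < d, v k ∈ Set.Icc (b k) (b k + 1)}

theorem update_mem_gridCell_succ {b v : ℕ → ℕ} {m c : ℕ} (hv : v ∈ gridCell d b)
    (hc : c ∈ Set.Icc m (m + 1)) :
    Function.update v d c ∈ gridCell (d + 1) (Function.update b d m) := by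
  intro k hk
  rcases Nat.lt_succ_iff_lt_or_eq.1 hk with hk | rfl
  · simpa [Function.update_of_ne hk.ne] using hv k hk
  · simpa using hc

theorem exists_gridCell_of_gridIntegral_ne_zero (h : gridIntegral n d ω ≠ 0) :
    ∃ b L, ω L ≠ 0 ∧ ∀ v ∈ L, v ∈ gridCell d b := by
  induction d generalizing ω with
  | zero => exact ⟨0, [0], h, by simp [gridCell]⟩
  | succ d ih =>
    obtain ⟨b, L, hL, hLb⟩ := ih h
    obtain ⟨m, L', hL', hw⟩ := exists_of_fiberIntegral_ne_zero hL
    refine ⟨Function.update b d m, L', hL', fun w hwL => ?_⟩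
    obtain ⟨v, hv, rfl | rfl⟩ := hw w hwL <;>
      exact update_mem_gridCell_succ (hLb v hv) (by simp)

/-- The cochain `θ` vanishes on the simplices lying in one of the faces `v k = 0` and `v k = n`,
`k < d`, of the grid `{0, …, n} ^ d`. -/
def VanishesOnFaces (n d : ℕ) (θ : List (ℕ → ℕ) → R) : Prop :=
  ∀ k < d, ∀ c, c = 0 ∨ c = n → ∀ L, (∀ v ∈ L, v k = c) → θ L = 0

theorem VanishesOnFaces.mono {d' : ℕ} (h : VanishesOnFaces n d θ) (hd : d' ≤ d) :
    VanishesOnFaces n d' θ :=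
  fun k hk => h k (hk.trans_le hd)

theorem VanishesOnFaces.fiberIntegral (h : VanishesOnFaces n d θ) :
    VanishesOnFaces n d (fiberIntegral n d θ) := by
  intro k hk c hc L hL
  by_contra hne
  obtain ⟨m, L', hL', hw⟩ := exists_of_fiberIntegral_ne_zero hne
  refine hL' (h k hk c hc L' fun w hwL => ?_)
  obtain ⟨v, hv, rfl | rfl⟩ := hw w hwL <;> simpa [Function.update_of_ne hk.ne] using hL v hv

/-- **Stokes' theorem** on the grid, for cochains vanishing on the boundary. -/
theorem gridIntegral_coboundary (h : VanishesOnFaces n d θ) (hnil : θ [] = 0) :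
    gridIntegral n d (coboundary θ) = 0 := by
  induction d generalizing θ with
  | zero => simpa [gridIntegral, coboundary_cons] using hnil
  | succ d ih =>
    have hface : ∀ c, c = 0 ∨ c = n → θ ∘ List.map (fun v => Function.update v d c) = 0 :=
      fun c hc => funext fun L => h d d.lt_succ_self c hc _ (by simp)
    have hfiber : VanishesOnFaces n d (fiberIntegral n d θ) :=
      (h.mono d.le_succ).fiberIntegral
    rw [gridIntegral, LinearMap.comp_apply, fiberIntegral_coboundary, hface n (.inr rfl),
      hface 0 (.inl rfl), sub_zero, zero_sub, map_neg, ih hfiber (by simp [fiberIntegral_apply]),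
      neg_zero]

variable {f : ℕ → (ℕ → ℕ) → R}

theorem vanishesOnFaces_cupZero_cupCoboundaries (h0 : ∀ k < d, ∀ v, v k = 0 → f k v = 0)
    (h1 : ∀ k < d, ∀ v, v k = n → f k v = 1) (g : (ℕ → ℕ) → R) :
    VanishesOnFaces n d (cupZero g (cupCoboundaries f d)) := by
  have hconst : ∀ k < d, ∀ c, c = 0 ∨ c = n → ∀ v w, v k = c → w k = c → f k v = f k w := by
    rintro k hk c (rfl | rfl) v w hv hw
    · rw [h0 k hk v hv, h0 k hk w hw]
    · rw [h1 k hk v hv, h1 k hk w hw]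
  rintro k hk c hc (_ | ⟨v, L⟩) hL
  · rfl
  · by_contra hne
    obtain ⟨x, hx, y, hy, hxy⟩ :=
      exists_ne_of_cupCoboundaries_ne_zero (right_ne_zero_of_mul hne) hk
    exact hxy (hconst k hk c hc x y (hL x hx) (hL y hy))

theorem gridIntegral_cupCoboundaries (h0 : ∀ k < d, ∀ v, v k = 0 → f k v = 0)
    (h1 : ∀ k < d, ∀ v, v k = n → f k v = 1) : gridIntegral n d (cupCoboundaries f d) = 1 := by
  induction d generalizing f with
  | zero => simp [gridIntegral, cupCoboundaries]
  | succ d ih =>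
    set θ := cupZero (f d) (cupCoboundaries f d)
    have hθ : VanishesOnFaces n d (fiberIntegral n d θ) :=
      (vanishesOnFaces_cupZero_cupCoboundaries (fun k hk => h0 k (hk.trans d.lt_succ_self))
        (fun k hk => h1 k (hk.trans d.lt_succ_self)) _).fiberIntegral
    have hbot : θ ∘ List.map (fun v => Function.update v d 0) = 0 := by
      funext L
      cases L <;> simp [θ, cupZero, h0 d d.lt_succ_self]
    have htop : θ ∘ List.map (fun v => Function.update v d n) =
        cupCoboundaries (fun j => f j ∘ fun v => Function.update v d n) d := by
      rw [← cupCoboundaries_comp_map]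
      funext L
      cases L <;> simp [θ, cupZero, h1 d d.lt_succ_self]
    rw [gridIntegral, LinearMap.comp_apply, cupCoboundaries, fiberIntegral_coboundary, hbot, htop,
      sub_zero, map_sub, gridIntegral_coboundary hθ (by simp [fiberIntegral_apply]), sub_zero]
    exact ih (fun k hk v hv => h0 k (hk.trans d.lt_succ_self) _ (by simp [hv, hk.ne]))
      fun k hk v hv => h1 k (hk.trans d.lt_succ_self) _ (by simp [hv, hk.ne])

/-- A discrete **Poincaré–Miranda theorem**. -/
theorem exists_gridCell_inter_nonempty_diff_nonempty {A : Fin d → Set (ℕ → ℕ)}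
    (h0 : ∀ (k : Fin d) v, v k = 0 → v ∉ A k) (h1 : ∀ (k : Fin d) v, v k = n → v ∈ A k) :
    ∃ b, ∀ k, (gridCell d b ∩ A k).Nonempty ∧ (gridCell d b \ A k).Nonempty := by
  classical
  let f : ℕ → (ℕ → ℕ) → ℤ := fun k v => if ∃ hk : k < d, v ∈ A ⟨k, hk⟩ then 1 else 0
  have hf : ∀ (k : Fin d) v, f k v = if v ∈ A k then 1 else 0 := fun k v => by simp [f]
  have hintegral : gridIntegral n d (cupCoboundaries f d) = 1 :=
    gridIntegral_cupCoboundaries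
      (fun k hk v hv => (hf ⟨k, hk⟩ v).trans (if_neg (h0 ⟨k, hk⟩ v hv)))
      (fun k hk v hv => (hf ⟨k, hk⟩ v).trans (if_pos (h1 ⟨k, hk⟩ v hv)))
  obtain ⟨b, L, hL, hLb⟩ :=
    exists_gridCell_of_gridIntegral_ne_zero (hintegral.trans_ne one_ne_zero)
  refine ⟨b, fun k => ?_⟩
  obtain ⟨v, hv, w, hw, hvw⟩ := exists_ne_of_cupCoboundaries_ne_zero hL k.2
  rw [hf, hf] at hvw
  by_cases hvA : v ∈ A k <;> by_cases hwA : w ∈ A k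
  · simp [hvA, hwA] at hvw
  · exact ⟨⟨v, hLb v hv, hvA⟩, ⟨w, hLb w hw, hwA⟩⟩
  · exact ⟨⟨w, hLb w hw, hwA⟩, ⟨v, hLb v hv, hvA⟩⟩
  · simp [hvA, hwA] at hvw

end Grid

section Cube

variable {d : ℕ}

/-- The point of the cube with coordinates `v j / n`, cut off at `1`. -/
noncomputable def gridPoint (d n : ℕ) (v : ℕ → ℕ) : Fin d → unitInterval :=
  fun j => Set.projIcc (0 : ℝ) 1 zero_le_one ((v j : ℝ) / n)

theorem gridPoint_eq_zero {n : ℕ} {v : ℕ → ℕ} {j : Fin d} (hv : v j = 0) :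
    gridPoint d n v j = 0 := by
  simp only [gridPoint, hv, Nat.cast_zero, zero_div, Set.projIcc_left]
  rfl

theorem gridPoint_eq_one {n : ℕ} (hn : n ≠ 0) {v : ℕ → ℕ} {j : Fin d} (hv : v j = n) :
    gridPoint d n v j = 1 := by
  simp only [gridPoint, hv, div_self (Nat.cast_ne_zero.2 hn : (n : ℝ) ≠ 0), Set.projIcc_right]
  rfl

theorem dist_gridPoint_le {n : ℕ} {b v : ℕ → ℕ} (hv : v ∈ gridCell d b) :
    dist (gridPoint d n v) (gridPoint d n b) ≤ 1 / n := by
  refine (dist_pi_le_iff (by positivity)).2 fun j => ?_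
  obtain ⟨hbv, hvb⟩ := hv j j.2
  have hle : |(v j : ℝ) - b j| ≤ 1 := by
    have hbv' : (b j : ℝ) ≤ v j := by exact_mod_cast hbv
    have hvb' : (v j : ℝ) ≤ b j + 1 := by exact_mod_cast hvb
    rw [abs_le]
    constructor <;> linarith
  calc dist (gridPoint d n v j) (gridPoint d n b j) ≤ |(v j : ℝ) / n - b j / n| :=
        Set.abs_projIcc_sub_projIcc zero_le_one
    _ = |(v j : ℝ) - b j| / n := by rw [← sub_div, abs_div, Nat.abs_cast]
    _ ≤ 1 / n := by gcongr

variable {H : (Fin d → unitInterval) → Fin d → ℝ}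

theorem exists_norm_lt_of_faces (hH : Continuous H) (h0 : ∀ x j, x j = 0 → H x j ≤ 0)
    (h1 : ∀ x j, x j = 1 → 0 ≤ H x j) {ε : ℝ} (hε : 0 < ε) : ∃ x, ‖H x‖ < ε := by
  obtain ⟨δ, hδ, hHδ⟩ :=
    Metric.uniformContinuous_iff.1 (CompactSpace.uniformContinuous_of_continuous hH) ε hε
  obtain ⟨N, hN⟩ := exists_nat_one_div_lt hδ
  set n := N + 1
  have hn : n ≠ 0 := N.succ_ne_zero
  let A : Fin d → Set (ℕ → ℕ) := fun k =>
    {v | v k ≠ 0 ∧ (v k = n ∨ 0 ≤ H (gridPoint d n v) k)}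
  have hnonneg : ∀ k, ∀ v ∈ A k, 0 ≤ H (gridPoint d n v) k := by
    rintro k v ⟨-, hv | hv⟩
    exacts [h1 _ k (gridPoint_eq_one hn hv), hv]
  have hnonpos : ∀ k, ∀ v ∉ A k, H (gridPoint d n v) k ≤ 0 := by
    intro k v hv
    by_cases hvk : v k = 0
    · exact h0 _ k (gridPoint_eq_zero hvk)
    · exact (not_le.1 fun hle => hv ⟨hvk, .inr hle⟩).le
  obtain ⟨b, hb⟩ := exists_gridCell_inter_nonempty_diff_nonempty (n := n) (A := A)
    (fun k v hv hvA => hvA.1 hv) (fun k v hv => ⟨hv.trans_ne hn, .inl hv⟩)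
  have hclose : ∀ k, ∀ v ∈ gridCell d b, |H (gridPoint d n v) k - H (gridPoint d n b) k| < ε :=
    fun k v hv => (dist_le_pi_dist _ _ k).trans_lt
      (hHδ ((dist_gridPoint_le hv).trans_lt (by exact_mod_cast hN)))
  refine ⟨gridPoint d n b, (pi_norm_lt_iff hε).2 fun k => ?_⟩
  obtain ⟨⟨v, hv, hvA⟩, w, hw, hwA⟩ := hb k
  rw [Real.norm_eq_abs, abs_lt]
  constructor
  · linarith [hnonneg k v hvA, (abs_lt.1 (hclose k v hv)).2]
  · linarith [hnonpos k w hwA, (abs_lt.1 (hclose k w hw)).1]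

/-- The **Poincaré–Miranda theorem**. -/
theorem exists_eq_zero_of_faces (hH : Continuous H) (h0 : ∀ x j, x j = 0 → H x j ≤ 0)
    (h1 : ∀ x j, x j = 1 → 0 ≤ H x j) : ∃ x, H x = 0 := by
  obtain ⟨x₀, -, hmin⟩ := isCompact_univ.exists_isMinOn Set.univ_nonempty hH.norm.continuousOn
  refine ⟨x₀, by_contra fun hne => ?_⟩
  obtain ⟨x, hx⟩ := exists_norm_lt_of_faces hH h0 h1 (norm_pos_iff.2 hne)
  exact hx.not_ge (hmin (Set.mem_univ x))

/-- A cubical form of the **Knaster–Kuratowski–Mazurkiewicz lemma**. -/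
theorem exists_forall_mem_of_faces {C : Fin (d + 1) → Set (Fin d → unitInterval)}
    (hopen : ∀ k, IsOpen (C k)) (hcover : ∀ x, ∃ k, x ∈ C k)
    (h0 : ∀ (j : Fin d) x, x j = 0 → x ∉ C j.castSucc)
    (h1 : ∀ (j : Fin d) x, x j = 1 → x ∉ C j.succ) : ∃ x, ∀ k, x ∈ C k := by
  obtain ⟨ρ, hρ⟩ := PartitionOfUnity.exists_isSubordinate isClosed_univ C hopen
    fun x _ => Set.mem_iUnion.2 (hcover x)
  have hmem : ∀ k x, ρ k x ≠ 0 → x ∈ C k := fun k x hx => hρ k (subset_tsupport _ hx)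
  obtain ⟨x, hx⟩ := exists_eq_zero_of_faces
    (H := fun x j => ρ j.castSucc x - ρ j.succ x) (by fun_prop)
    (fun x j hxj => by
      simp only [not_imp_comm.1 (hmem _ _) (h0 j x hxj), zero_sub, neg_nonpos, ρ.nonneg])
    (fun x j hxj => by
      simp only [not_imp_comm.1 (hmem _ _) (h1 j x hxj), sub_zero, ρ.nonneg])
  have hconst : ∀ k, ρ k x = ρ 0 x :=
    Fin.induction rfl fun j hj => (sub_eq_zero.1 (congrFun hx j)).symm.trans hj
  refine ⟨x, fun k => hmem k x fun hk => ?_⟩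
  obtain ⟨l, hl⟩ := ρ.exists_pos (Set.mem_univ x)
  rw [hconst l, ← hconst k, hk] at hl
  exact hl.false

theorem exists_fin_castSucc_succ {P Q : Fin d → Prop} (h : ∀ j, P j ∨ Q j) :
    ∃ k : Fin (d + 1), (∀ j, k = j.castSucc → P j) ∧ ∀ j, k = j.succ → Q j := by
  by_cases hQ : ∀ j, Q j
  · exact ⟨Fin.last d, fun j hj => absurd hj.symm j.castSucc_lt_last.ne, fun j _ => hQ j⟩
  · push Not at hQ
    obtain ⟨j₀, hj₀, hmin⟩ := WellFounded.has_min wellFounded_lt {j | ¬Q j} hQ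
    refine ⟨j₀.castSucc, fun j hj => ?_, fun j hj => ?_⟩
    · rw [← Fin.castSucc_injective d hj]
      exact (h j₀).resolve_right hj₀
    · have hlt : j < j₀ := Fin.castSucc_lt_castSucc_iff.1 (hj ▸ j.castSucc_lt_succ)
      exact not_not.1 fun hjQ => hmin j hjQ hlt

/-- The **Lebesgue covering theorem**. -/
theorem exists_le_ordAt_of_faces {𝒱 : Finset (Set (Fin d → unitInterval))} (h𝒱 : IsOpenCover 𝒱)
    (hface : ∀ V ∈ 𝒱, ∀ j, (∀ x ∈ V, x j ≠ 0) ∨ ∀ x ∈ V, x j ≠ 1) :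
    ∃ x, (d : ℝ) ≤ ordAt 𝒱 x := by
  classical
  choose! c hc0 hc1 using fun V (hV : V ∈ 𝒱) => exists_fin_castSucc_succ (hface V hV)
  obtain ⟨x, hx⟩ := exists_forall_mem_of_faces (C := fun k => ⋃ V ∈ 𝒱.filter (c · = k), V)
    (fun k => isOpen_biUnion fun V hV => h𝒱.1 V (Finset.mem_filter.1 hV).1)
    (fun x => by
      obtain ⟨V, hV, hxV⟩ := h𝒱.2 x
      exact ⟨c V, Set.mem_biUnion (Finset.mem_filter.2 ⟨hV, rfl⟩) hxV⟩)
    (fun j x hxj hxC => by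
      simp only [Set.mem_iUnion, Finset.mem_filter] at hxC
      obtain ⟨V, ⟨hV, hcV⟩, hxV⟩ := hxC
      exact hc0 V hV j hcV x hxV hxj)
    (fun j x hxj hxC => by
      simp only [Set.mem_iUnion, Finset.mem_filter] at hxC
      obtain ⟨V, ⟨hV, hcV⟩, hxV⟩ := hxC
      exact hc1 V hV j hcV x hxV hxj)
  have hsurj : Set.SurjOn c (𝒱.filter (x ∈ ·)) (Finset.univ : Finset (Fin (d + 1))) := by
    intro k _
    have hxk := hx k
    simp only [Set.mem_iUnion, Finset.mem_filter] at hxk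
    obtain ⟨V, ⟨hV, hcV⟩, hxV⟩ := hxk
    exact ⟨V, by simp [hV, hxV], hcV⟩
  have hcard : d + 1 ≤ (𝒱.filter (x ∈ ·)).card := by
    simpa using Finset.card_le_card_of_surjOn c hsurj
  have hcard' : (d : ℝ) + 1 ≤ (𝒱.filter (x ∈ ·)).card := by exact_mod_cast hcard
  exact ⟨x, by rw [ordAt_eq_card]; linarith⟩

end Cube

section LowerBound

/-- The cover of the cube by the complements of unions of `d` facets, one from each pair of opposite
facets. -/
noncomputable def facetFreeCover (d : ℕ) : Finset (Set (Fin d → unitInterval)) :=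
  open Classical in
  Finset.univ.image fun S : Finset (Fin d) => {x | ∀ j, x j ≠ if j ∈ S then 0 else 1}

theorem mem_facetFreeCover {d : ℕ} {U : Set (Fin d → unitInterval)} :
    U ∈ facetFreeCover d ↔ ∃ S : Finset (Fin d), {x | ∀ j, x j ≠ if j ∈ S then 0 else 1} = U := by
  classical
  simp [facetFreeCover]

theorem isOpenCover_facetFreeCover (d : ℕ) : IsOpenCover (facetFreeCover d) := by
  classical
  simp only [IsOpenCover, mem_facetFreeCover]
  refine ⟨?_, fun x => ⟨_, ⟨Finset.univ.filter (x · ≠ 0), rfl⟩, fun j => ?_⟩⟩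
  · rintro _ ⟨S, rfl⟩
    simp only [Set.ofPred_forall]
    exact isOpen_iInter_of_finite fun j => isOpen_ne_fun (continuous_apply j) continuous_const
  · by_cases h : x j = 0 <;> simp [h]

theorem exists_le_ordAt_of_refines_facetFreeCover {d : ℕ}
    {𝒱 : Finset (Set (Fin d → unitInterval))} (h𝒱 : IsOpenCover 𝒱)
    (href : Refines 𝒱 (facetFreeCover d)) : ∃ x, (d : ℝ) ≤ ordAt 𝒱 x := by
  refine exists_le_ordAt_of_faces h𝒱 fun V hV j => ?_
  obtain ⟨U, hU, hVU⟩ := href V hV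
  obtain ⟨S, rfl⟩ := mem_facetFreeCover.1 hU
  by_cases hj : j ∈ S
  · exact .inl fun x hx => by simpa [hj] using hVU hx j
  · exact .inr fun x hx => by simpa [hj] using hVU hx j

theorem diracProba_mem_invariantProb {Γ X : Type*} [Group Γ] [TopologicalSpace X]
    [MeasurableSpace X] [BorelSpace X] {T : Γ →* (X ≃ₜ X)} {x : X} (hx : ∀ γ, T γ x = x) :
    diracProba x ∈ invariantProb T := fun γ => by
  simp only [diracProba, ProbabilityMeasure.coe_mk,
    Measure.map_dirac' (T γ).continuous.measurable, hx γ]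

theorem ordAt_le_ordPair {X : Type*} [MeasurableSpace X] [MeasurableSingletonClass X]
    (𝒱 : Finset (Set X)) {P : Set (ProbabilityMeasure X)} {x : X}
    (hx : diracProba x ∈ P) : (ordAt 𝒱 x : EReal) ≤ ordPair 𝒱 P :=
  le_iSup₂_of_le (diracProba x) hx (by simp [diracProba])

theorem le_dimSystem_shift (Γ : Type*) [Group Γ] [Countable Γ] (d : ℕ) :
    (d : EReal) ≤ dimSystem (shift Γ (Fin d → unitInterval)) := by
  have heval : Continuous fun x : Γ → Fin d → unitInterval => x 1 := continuous_apply 1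
  refine le_iSup₂_of_le (pullback (fun x => x 1) (facetFreeCover d))
    ((isOpenCover_facetFreeCover d).pullback heval) (le_iInf₂ fun 𝒱 h𝒱 => ?_)
  obtain ⟨y, hy⟩ := exists_le_ordAt_of_refines_facetFreeCover
    (h𝒱.1.pullback (f := Function.const Γ) (by fun_prop))
    (h𝒱.2.pullback_of_leftInverse fun _ => rfl)
  calc (d : EReal) ≤ ordAt 𝒱 (Function.const Γ y) := by
        exact_mod_cast hy.trans (ordAt_pullback_le _ 𝒱 y)
    _ ≤ _ := ordAt_le_ordPair 𝒱 (diracProba_mem_invariantProb fun _ => rfl)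

end LowerBound

section CellCover

theorem eq_of_abs_sub_intCast_lt {t r : ℝ} {m m' : ℤ} (hr : r ≤ 1 / 2) (h : |t - m| < r)
    (h' : |t - m'| < r) : m = m' := by
  have hlt : |((m - m' : ℤ) : ℝ)| < 1 :=
    calc |((m - m' : ℤ) : ℝ)| = |(m : ℝ) - m'| := by push_cast; rfl
      _ ≤ |m - t| + |t - m'| := abs_sub_le _ _ _
      _ < 1 := by rw [abs_sub_comm]; linarith
  exact sub_eq_zero.1 (Int.abs_lt_one_iff.1 (by exact_mod_cast hlt))

variable {X ι : Type*} {u : ι → X → ℝ} {r : ℝ} {S S' : Finset ι} {τ τ' : ι → ℤ} {x y : X}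

/-- The points whose coordinates `u i` are near the integers `τ i` for `i ∈ S`, lie strictly between
`τ i` and `τ i + 1` for `i ∉ S`, and are nearer to the integers for `i ∈ S` than for `i ∉ S`. The
distance of `t` to the nearest integer is encoded as the norm of `t` in `ℝ / ℤ`. -/
def cell (u : ι → X → ℝ) (r : ℝ) (S : Finset ι) (τ : ι → ℤ) : Set X :=
  {x | (∀ i ∈ S, |u i x - τ i| < r) ∧ (∀ i ∉ S, (τ i : ℝ) < u i x ∧ u i x < τ i + 1) ∧
    ∀ i ∈ S, ∀ j ∉ S, ‖(u i x : UnitAddCircle)‖ < ‖(u j x : UnitAddCircle)‖}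

theorem abs_sub_lt_one_of_mem_cell (hr : r ≤ 1 / 2) (hx : x ∈ cell u r S τ)
    (hy : y ∈ cell u r S τ) (i : ι) : |u i x - u i y| < 1 := by
  by_cases hi : i ∈ S
  · calc |u i x - u i y| ≤ |u i x - τ i| + |τ i - u i y| := abs_sub_le _ _ _
      _ < 1 := by rw [abs_sub_comm (τ i : ℝ)]; linarith [hx.1 i hi, hy.1 i hi]
  · obtain ⟨hτx, hxτ⟩ := hx.2.1 i hi
    obtain ⟨hτy, hyτ⟩ := hy.2.1 i hi
    rw [abs_lt]
    constructor <;> linarith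

theorem subset_or_subset_of_mem_cell (hx : x ∈ cell u r S τ) (hx' : x ∈ cell u r S' τ') :
    S ⊆ S' ∨ S' ⊆ S := by
  by_contra! h
  obtain ⟨i, hi, hi'⟩ := Finset.not_subset.1 h.1
  obtain ⟨j, hj', hj⟩ := Finset.not_subset.1 h.2
  exact lt_asymm (hx.2.2 i hi j hj) (hx'.2.2 j hj' i hi')

theorem eq_of_mem_cell (hr : r ≤ 1 / 2) (hx : x ∈ cell u r S τ) (hx' : x ∈ cell u r S τ') :
    τ = τ' := by
  funext i
  by_cases hi : i ∈ S
  · exact eq_of_abs_sub_intCast_lt hr (hx.1 i hi) (hx'.1 i hi)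
  · obtain ⟨hτ, hτx⟩ := hx.2.1 i hi
    obtain ⟨hτ', hτx'⟩ := hx'.2.1 i hi
    rw [← Int.floor_eq_iff.2 ⟨hτ.le, hτx⟩, ← Int.floor_eq_iff.2 ⟨hτ'.le, hτx'⟩]

theorem norm_lt_of_mem_cell (hx : x ∈ cell u r S τ) {i : ι} (hi : i ∈ S) :
    ‖(u i x : UnitAddCircle)‖ < r := by
  rw [UnitAddCircle.norm_eq]
  exact (round_le _ _).trans_lt (hx.1 i hi)

theorem exists_mem_cell [Finite ι] (u : ι → X → ℝ) (hr : 0 < r) (x : X) :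
    ∃ S τ, (∀ i, |u i x - τ i| ≤ 1) ∧ x ∈ cell u r S τ := by
  classical
  have := Fintype.ofFinite ι
  let S : Finset ι := {i | ‖(u i x : UnitAddCircle)‖ = 0}
  have hS : ∀ i, i ∈ S ↔ ‖(u i x : UnitAddCircle)‖ = 0 := fun i => by
    simp only [S, Finset.mem_filter_univ]
  have hfloor : ∀ i ∈ S, u i x = ⌊u i x⌋ := by
    intro i hi
    rw [hS, UnitAddCircle.norm_eq, abs_eq_zero, sub_eq_zero] at hi
    rw [hi, Int.floor_intCast]
  refine ⟨S, fun i => ⌊u i x⌋, fun i => ?_, fun i hi => ?_, fun i hi => ?_, fun i hi j hj => ?_⟩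
  · rw [Int.self_sub_floor, abs_of_nonneg (Int.fract_nonneg (u i x))]
    exact (Int.fract_lt_one (u i x)).le
  · rwa [← hfloor i hi, sub_self, abs_zero]
  · refine ⟨(Int.floor_le _).lt_of_ne fun h => hi ((hS i).2 ?_), Int.lt_floor_add_one _⟩
    rw [UnitAddCircle.norm_eq, ← h, round_intCast, sub_self, abs_zero]
  · rw [(hS i).1 hi]
    exact (norm_nonneg _).lt_of_ne' (mt (hS j).2 hj)

theorem continuous_norm_coe_unitAddCircle : Continuous fun t : ℝ => ‖(t : UnitAddCircle)‖ :=
  continuous_norm.comp (AddCircle.continuous_mk' 1)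

theorem isOpen_cell [Finite ι] [TopologicalSpace X] (hu : ∀ i, Continuous (u i)) (r : ℝ)
    (S : Finset ι) (τ : ι → ℤ) : IsOpen (cell u r S τ) := by
  have hnorm : ∀ i, Continuous fun x => ‖(u i x : UnitAddCircle)‖ := fun i =>
    continuous_norm_coe_unitAddCircle.comp (hu i)
  simp only [cell, Set.ofPred_and, Set.ofPred_forall]
  refine .inter ?_ (.inter ?_ ?_)
  · exact isOpen_iInter_of_finite fun i => isOpen_iInter_of_finite fun _ =>
      isOpen_lt ((hu i).sub continuous_const).abs continuous_const
  · exact isOpen_iInter_of_finite fun i => isOpen_iInter_of_finite fun _ =>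
      (isOpen_lt continuous_const (hu i)).inter (isOpen_lt (hu i) continuous_const)
  · exact isOpen_iInter_of_finite fun i => isOpen_iInter_of_finite fun _ =>
      isOpen_iInter_of_finite fun j => isOpen_iInter_of_finite fun _ =>
        isOpen_lt (hnorm i) (hnorm j)

variable [Fintype ι] {K : Finset ℤ}

open Classical in
/-- The collection of the cells whose integers `τ i` all lie in `K`; restricting to a finite `K` is
what makes the collection finite. -/
noncomputable def cellCover (u : ι → X → ℝ) (r : ℝ) (K : Finset ℤ) : Finset (Set X) :=
  (Finset.univ ×ˢ Fintype.piFinset fun _ => K).image fun p : Finset ι × (ι → ℤ) => cell u r p.1 p.2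

theorem mem_cellCover {V : Set X} :
    V ∈ cellCover u r K ↔ ∃ S τ, (∀ i, τ i ∈ K) ∧ cell u r S τ = V := by
  simp [cellCover]

theorem isOpenCover_cellCover [TopologicalSpace X] (hu : ∀ i, Continuous (u i)) (hr : 0 < r)
    (hK : ∀ i x, ∀ m : ℤ, |u i x - m| ≤ 1 → m ∈ K) : IsOpenCover (cellCover u r K) := by
  simp only [IsOpenCover, mem_cellCover]
  refine ⟨?_, fun x => ?_⟩
  · rintro _ ⟨S, τ, -, rfl⟩
    exact isOpen_cell hu r S τ
  · obtain ⟨S, τ, hτ, hx⟩ := exists_mem_cell u hr x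
    exact ⟨_, ⟨S, τ, fun i => hK i x _ (hτ i), rfl⟩, hx⟩

theorem exists_isOpenCover_cellCover [TopologicalSpace X] [CompactSpace X]
    (hu : ∀ i, Continuous (u i)) (hr : 0 < r) : ∃ K, IsOpenCover (cellCover u r K) := by
  have hbdd : ∀ i, ∃ C, ∀ x, |u i x| ≤ C := fun i =>
    (isCompact_univ.exists_bound_of_continuousOn (hu i).continuousOn).imp fun _ hC x =>
      hC x (Set.mem_univ x)
  choose C hC using hbdd
  have hfin : ∀ i, {m : ℤ | |(m : ℝ)| ≤ C i + 1}.Finite := fun i =>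
    (Set.finite_Icc (-⌊C i + 1⌋) ⌊C i + 1⌋).subset fun m hm => by
      rw [Set.mem_Icc, ← abs_le, Int.le_floor]
      exact_mod_cast hm
  refine ⟨(Set.finite_iUnion hfin).toFinset, isOpenCover_cellCover hu hr fun i x m hm => ?_⟩
  rw [Set.Finite.mem_toFinset]
  refine Set.mem_iUnion.2 ⟨i, ?_⟩
  calc |(m : ℝ)| = |u i x - (u i x - m)| := by rw [sub_sub_cancel]
    _ ≤ |u i x| + |u i x - m| := abs_sub _ _
    _ ≤ C i + 1 := add_le_add (hC i x) hm

theorem card_filter_mem_cellCover_le (hr : r ≤ 1 / 2) (x : X)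
    [DecidablePred fun V : Set X => x ∈ V] :
    ((cellCover u r K).filter fun V => x ∈ V).card ≤
      (Finset.univ.filter fun i => ‖(u i x : UnitAddCircle)‖ < r).card + 1 := by
  set T : Finset ι := Finset.univ.filter fun i => ‖(u i x : UnitAddCircle)‖ < r
  rw [← Finset.card_range (T.card + 1)]
  -- The index sets `S` of the cells containing `x` form a chain of subsets of `T`.
  refine Finset.card_le_card_of_forall_subsingleton
    (fun V k => ∃ S τ, S.card = k ∧ cell u r S τ = V) (fun V hV => ?_) (fun k _ => ?_)
  · obtain ⟨hV, hx⟩ := Finset.mem_filter.1 hV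
    obtain ⟨S, τ, -, rfl⟩ := mem_cellCover.1 hV
    have hST : S ⊆ T := fun i hi => by simpa [T] using norm_lt_of_mem_cell hx hi
    exact ⟨S.card, Finset.mem_range_succ_iff.2 (Finset.card_le_card hST), S, τ, rfl, rfl⟩
  · rintro _ ⟨hV, S, τ, hS, rfl⟩ _ ⟨hV', S', τ', hS', rfl⟩
    have hx := (Finset.mem_filter.1 hV).2
    have hx' := (Finset.mem_filter.1 hV').2
    obtain rfl : S = S' := by
      rcases subset_or_subset_of_mem_cell hx hx' with h | h
      · exact Finset.eq_of_subset_of_card_le h (hS'.trans hS.symm).le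
      · exact (Finset.eq_of_subset_of_card_le h (hS.trans hS'.symm).le).symm
    rw [eq_of_mem_cell hr hx hx']

theorem ordAt_cellCover_le (hr : r ≤ 1 / 2) (x : X) :
    ordAt (cellCover u r K) x ≤
      ∑ i, {x | ‖(u i x : UnitAddCircle)‖ < r}.indicator (1 : X → ℝ) x := by
  classical
  have hsum : ∑ i, {x | ‖(u i x : UnitAddCircle)‖ < r}.indicator (1 : X → ℝ) x =
      (Finset.univ.filter fun i => ‖(u i x : UnitAddCircle)‖ < r).card := by
    simp [Set.indicator_apply]
  have hcard : (((cellCover u r K).filter (x ∈ ·)).card : ℝ) ≤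
      (Finset.univ.filter fun i => ‖(u i x : UnitAddCircle)‖ < r).card + 1 := by
    exact_mod_cast card_filter_mem_cellCover_le (u := u) (K := K) hr x
  rw [ordAt_eq_card, hsum]
  linarith

theorem integral_ordAt_cellCover_le [TopologicalSpace X] [MeasurableSpace X] [BorelSpace X]
    (hu : ∀ i, Continuous (u i)) (hr : r ≤ 1 / 2) (hcover : IsOpenCover (cellCover u r K))
    (μ : Measure X) [IsFiniteMeasure μ] :
    ∫ x, ordAt (cellCover u r K) x ∂μ ≤ ∑ i, μ.real {x | ‖(u i x : UnitAddCircle)‖ < r} := by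
  have hmeas : ∀ i, MeasurableSet {x | ‖(u i x : UnitAddCircle)‖ < r} := fun i =>
    (isOpen_lt (continuous_norm_coe_unitAddCircle.comp (hu i)) continuous_const).measurableSet
  have hint : ∀ i, Integrable ({x | ‖(u i x : UnitAddCircle)‖ < r}.indicator (1 : X → ℝ)) μ :=
    fun i => (integrable_const (1 : ℝ)).indicator (hmeas i)
  calc ∫ x, ordAt (cellCover u r K) x ∂μ
      ≤ ∫ x, ∑ i, {x | ‖(u i x : UnitAddCircle)‖ < r}.indicator (1 : X → ℝ) x ∂μ :=
        integral_mono (integrable_ordAt hcover μ) (integrable_finsetSum _ fun i _ => hint i)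
          (ordAt_cellCover_le hr)
    _ = ∑ i, μ.real {x | ‖(u i x : UnitAddCircle)‖ < r} := by
        rw [integral_finsetSum _ fun i _ => hint i]
        exact Finset.sum_congr rfl fun i _ => integral_indicator_one (hmeas i)

end CellCover

section UpperBound

theorem exists_pairwise_disjoint_ball_unitAddCircle (ι : Type*) [Finite ι] :
    ∃ c : ι → ℝ, ∃ r > 0, r ≤ 1 / 2 ∧
      Pairwise (Function.onFun Disjoint fun i => Metric.ball (c i : UnitAddCircle) r) := by
  obtain ⟨f, hf⟩ := Countable.exists_injective_nat ι
  let e : ℕ ↪ Set.Ico (0 : ℝ) 1 := Infinite.natEmbedding _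
  let c : ι → ℝ := fun i => e (f i)
  have hc : ∀ i, c i ∈ Set.Ico (0 : ℝ) (0 + 1) := fun i => by
    rw [zero_add]
    exact (e (f i)).2
  have hdist : ∀ i j, i ≠ j → 0 < dist (c i : UnitAddCircle) (c j) := fun i j hij =>
    dist_pos.2 fun h => hij (hf (e.injective (Subtype.ext
      ((AddCircle.coe_eq_coe_iff_of_mem_Ico (hc i) (hc j)).1 h))))
  have hball : ∀ᶠ r in nhdsWithin (0 : ℝ) (Set.Ioi 0), ∀ i j, i ≠ j →
      Disjoint (Metric.ball (c i : UnitAddCircle) r) (Metric.ball (c j) r) := by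
    simp only [Filter.eventually_all]
    intro i j hij
    filter_upwards [nhdsWithin_le_nhds (eventually_lt_nhds (half_pos (hdist i j hij)))] with r hr
    exact Metric.ball_disjoint_ball (by linarith)
  obtain ⟨r, ⟨hr, hr2⟩, hr0⟩ := ((hball.and (nhdsWithin_le_nhds
    (eventually_le_nhds (one_half_pos (α := ℝ))))).and self_mem_nhdsWithin).exists
  exact ⟨c, r, hr0, hr2, fun i j hij => hr i j hij⟩

variable {Γ K : Type*}

theorem exists_lebesgue_number_pi [PseudoMetricSpace K] [CompactSpace K]
    {𝒰 : Finset (Set (Γ → K))} (h𝒰 : IsOpenCover 𝒰) :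
    ∃ F : Finset Γ, ∃ ε > 0, ∀ x : Γ → K, ∃ U ∈ 𝒰, {y | ∀ γ ∈ F, dist (x γ) (y γ) < ε} ⊆ U := by
  obtain ⟨N, hN, hball⟩ := lebesgue_number_lemma_sUnion (S := (𝒰 : Set (Set (Γ → K))))
    isCompact_univ h𝒰.1 (fun x _ => h𝒰.2 x)
  rw [Pi.uniformity, (Filter.HasBasis.iInf' fun γ =>
    Metric.uniformity_basis_dist.comap fun a : (Γ → K) × (Γ → K) => (a.1 γ, a.2 γ)).mem_iff] at hN
  obtain ⟨⟨I, ε⟩, ⟨hI, hε⟩, hIN⟩ := hN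
  have hmin : ∀ᶠ δ : ℝ in nhdsWithin 0 (Set.Ioi 0), ∀ γ ∈ I, δ < ε γ :=
    (Filter.eventually_all_finite hI).2 fun γ hγ =>
      nhdsWithin_le_nhds (eventually_lt_nhds (hε γ hγ))
  obtain ⟨δ, hδε, hδ⟩ := (hmin.and self_mem_nhdsWithin).exists
  refine ⟨hI.toFinset, δ, hδ, fun x => ?_⟩
  obtain ⟨U, hU, hxU⟩ := hball x (Set.mem_univ x)
  refine ⟨U, hU, fun y hy => hxU (hIN (Set.mem_iInter₂.2 fun γ hγ => ?_))⟩
  exact (hy γ (hI.mem_toFinset.2 hγ)).trans (hδε γ hγ)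

theorem map_eval_eq_of_mem_invariantProb [Group Γ] [TopologicalSpace K] [MeasurableSpace K]
    {μ : ProbabilityMeasure (Γ → K)} (hμ : μ ∈ invariantProb (shift Γ K)) (γ : Γ) :
    (μ : Measure (Γ → K)).map (Function.eval γ) = (μ : Measure (Γ → K)).map (Function.eval 1) := by
  have hshift : Measurable (shift Γ K γ⁻¹) := measurable_pi_lambda _ fun _ => measurable_pi_apply _
  have heval : (Function.eval γ : (Γ → K) → K) = Function.eval 1 ∘ shift Γ K γ⁻¹ := by
    funext x
    simp [shift]
  rw [heval, ← Measure.map_map (measurable_pi_apply 1) hshift, hμ γ⁻¹]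

theorem sum_measureReal_preimage_eval_le_one [Group Γ] [TopologicalSpace K] [MeasurableSpace K]
    {μ : ProbabilityMeasure (Γ → K)} (hμ : μ ∈ invariantProb (shift Γ K)) {ι : Type*} [Fintype ι]
    (g : ι → Γ) {A : ι → Set K} (hA : ∀ i, MeasurableSet (A i))
    (hdisj : Pairwise (Function.onFun Disjoint A)) :
    ∑ i, (μ : Measure (Γ → K)).real {x | x (g i) ∈ A i} ≤ 1 := by
  set ν := (μ : Measure (Γ → K)).map (Function.eval 1)
  have : IsProbabilityMeasure ν :=
    Measure.isProbabilityMeasure_map (measurable_pi_apply 1).aemeasurable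
  have heq : ∀ i, (μ : Measure (Γ → K)).real {x | x (g i) ∈ A i} = ν.real (A i) := fun i =>
    calc (μ : Measure (Γ → K)).real {x | x (g i) ∈ A i}
        = ((μ : Measure (Γ → K)).map (Function.eval (g i))).real (A i) :=
          (map_measureReal_apply (measurable_pi_apply (g i)) (hA i)).symm
      _ = ν.real (A i) := by rw [map_eval_eq_of_mem_invariantProb hμ (g i)]
  calc ∑ i, (μ : Measure (Γ → K)).real {x | x (g i) ∈ A i} = ∑ i, ν.real (A i) :=
        Finset.sum_congr rfl fun i _ => heq i
    _ ≤ ν.real Set.univ :=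
        sum_measureReal_le_measureReal_univ (fun i _ => hA i) fun i _ j _ hij => hdisj hij
    _ = 1 := by simp

variable {d : ℕ} {F : Finset Γ} {ε : ℝ} {c : F → ℝ} {r : ℝ}

/-- The coordinate `x γ j` measured in units of `ε` and translated by an offset that depends on
`γ`. -/
noncomputable def rescaledCoord (ε : ℝ) (c : F → ℝ) (i : F × Fin d)
    (x : Γ → Fin d → unitInterval) : ℝ :=
  (x i.1 i.2 : ℝ) / ε - c i.1

theorem continuous_rescaledCoord (ε : ℝ) (c : F → ℝ) (i : F × Fin d) :
    Continuous (rescaledCoord ε c i) := by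
  unfold rescaledCoord
  fun_prop

theorem dist_lt_of_abs_rescaledCoord_sub_lt (hε : 0 < ε) {x y : Γ → Fin d → unitInterval}
    (h : ∀ i : F × Fin d, |rescaledCoord ε c i x - rescaledCoord ε c i y| < 1) {γ : Γ}
    (hγ : γ ∈ F) : dist (x γ) (y γ) < ε := by
  refine (dist_pi_lt_iff hε).2 fun j => ?_
  have hj := h (⟨γ, hγ⟩, j)
  rwa [rescaledCoord, rescaledCoord, sub_sub_sub_cancel_right, ← sub_div, abs_div,
    abs_of_pos hε, div_lt_one hε] at hj

theorem refines_cellCover_rescaledCoord {𝒰 : Finset (Set (Γ → Fin d → unitInterval))}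
    (hε : 0 < ε) (hr : r ≤ 1 / 2) (c : F → ℝ) (K : Finset ℤ)
    (h𝒰 : ∀ x : Γ → Fin d → unitInterval, ∃ U ∈ 𝒰, {y | ∀ γ ∈ F, dist (x γ) (y γ) < ε} ⊆ U) :
    Refines (cellCover (rescaledCoord ε c) r K) 𝒰 := by
  intro V hV
  obtain ⟨S, τ, -, rfl⟩ := mem_cellCover.1 hV
  rcases (cell (rescaledCoord ε c) r S τ).eq_empty_or_nonempty with hempty | ⟨x, hx⟩
  · obtain ⟨U, hU, -⟩ := h𝒰 0
    exact ⟨U, hU, hempty ▸ Set.empty_subset U⟩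
  · obtain ⟨U, hU, hxU⟩ := h𝒰 x
    exact ⟨U, hU, fun y hy => hxU fun γ hγ =>
      dist_lt_of_abs_rescaledCoord_sub_lt hε (abs_sub_lt_one_of_mem_cell hr hx hy) hγ⟩

variable [Group Γ]

theorem sum_measureReal_norm_rescaledCoord_lt_le (ε : ℝ)
    (hc : Pairwise (Function.onFun Disjoint fun γ => Metric.ball (c γ : UnitAddCircle) r))
    {μ : ProbabilityMeasure (Γ → Fin d → unitInterval)}
    (hμ : μ ∈ invariantProb (shift Γ (Fin d → unitInterval))) :
    ∑ i : F × Fin d, (μ : Measure (Γ → Fin d → unitInterval)).real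
      {x | ‖(rescaledCoord ε c i x : UnitAddCircle)‖ < r} ≤ d := by
  have hcoord : ∀ j : Fin d, ∑ γ, (μ : Measure (Γ → Fin d → unitInterval)).real
      {x | ‖(rescaledCoord ε c (γ, j) x : UnitAddCircle)‖ < r} ≤ 1 := by
    intro j
    let f : (Fin d → unitInterval) → UnitAddCircle := fun z => ((z j / ε : ℝ) : UnitAddCircle)
    have hf : Continuous f := (AddCircle.continuous_mk' 1).comp (by fun_prop)
    convert sum_measureReal_preimage_eval_le_one hμ (fun γ : F => (γ : Γ))
      (A := fun γ => f ⁻¹' Metric.ball (c γ : UnitAddCircle) r)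
      (fun γ => (Metric.isOpen_ball.preimage hf).measurableSet)
      (fun γ γ' hne => (hc hne).preimage f) using 5 with γ
    simp [f, rescaledCoord, dist_eq_norm]
  calc _ = ∑ j : Fin d, ∑ γ, (μ : Measure (Γ → Fin d → unitInterval)).real
        {x | ‖(rescaledCoord ε c (γ, j) x : UnitAddCircle)‖ < r} := Fintype.sum_prod_type_right _
    _ ≤ ∑ _j : Fin d, (1 : ℝ) := Finset.sum_le_sum fun j _ => hcoord j
    _ = d := by simp

variable (Γ d) in
theorem dimSystem_shift_le [Countable Γ] : dimSystem (shift Γ (Fin d → unitInterval)) ≤ d := by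
  refine iSup₂_le fun 𝒰 h𝒰 => ?_
  obtain ⟨F, ε, hε, hFε⟩ := exists_lebesgue_number_pi h𝒰
  obtain ⟨c, r, hr0, hr, hc⟩ := exists_pairwise_disjoint_ball_unitAddCircle F
  have hu := continuous_rescaledCoord (d := d) ε c
  obtain ⟨K, hK⟩ := exists_isOpenCover_cellCover hu hr0
  refine iInf₂_le_of_le _ ⟨hK, refines_cellCover_rescaledCoord hε hr c K hFε⟩
    (iSup₂_le fun μ hμ => ?_)
  exact_mod_cast EReal.coe_le_coe ((integral_ordAt_cellCover_le hu hr hK μ).trans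
    (sum_measureReal_norm_rescaledCoord_lt_le ε hc hμ))

end UpperBound

end CubicalShift

theorem theorem8p1 (Γ : Type*) [Group Γ] [Countable Γ] (d : ℕ) :
    CubicalShift.dimSystem (CubicalShift.shift Γ (Fin d → unitInterval)) = (d : EReal) :=
  le_antisymm (CubicalShift.dimSystem_shift_le Γ d) (CubicalShift.le_dimSystem_shift Γ d)
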